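/- **Theorem 1 (Attainable Beliefs).** Consider a network with $S$ sending sub-networks, whose agents $j$ are partitioned into index sets $\mathcal I_1,\dots,\mathcal I_S$ and whose true states $\theta_1^\circ,\dots,\theta_S^\circ$ are distinct, and with $N_{gR}$ receiving agents. It is prescribed which sending agents $j$ are linked to which receiving agents $k$. Let $T_{RR}\ge 0$ be the fixed $N_{gR}\times N_{gR}$ matrix of weights among receiving agents (entry $(\ell,k)$ is the weight that agent $k$ gives to agent $\ell$), with column sums at most $1$, and assume that every receiving agent either is linked to some sending agent or is the end of a directed path of positive weights of $T_{RR}$ that starts at a receiving agent linked to some sending agent. Let $C$ be the $S\times N_{gR}$ matrix with $C_{s,k}=1$ if $k$ is linked to at least one agent of $\mathcal I_s$, and $C_{s,k}=0$ otherwise. A matrix $T_{SR}$ of weights from sending to receiving agents is *admissible* if - its entries are nonnegative; - its entry $(j,k)$ is $0$ whenever $j$ and $k$ are not linked; - $\mathbb 1^{\mathsf T}T_{SR}+\mathbb 1^{\mathsf T}T_{RR}=\mathbb 1^{\mathsf T}$; - whenever $C_{s,k}=1$, at least one of the entries $(j,k)$ with $j\in\mathcal I_s$ is positive. With $W=T_{SR}(I-T_{RR})^{-1}$,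 the limiting belief of receiving agent $k$ at a state $\theta$ is $\sum_{s:\,\theta_s^\circ=\theta}\ \sum_{j\in\mathcal I_s}W_{j,k}$. Let $Q$ be an $S\times N_{gR}$ matrix whose columns are probability vectors, $Q_{s,k}$ being the desired limiting belief of receiving agent $k$ at $\theta_s^\circ$. Call $Q$ *attainable* if there is an admissible $T_{SR}$ for which the limiting belief of $k$ at $\theta_s^\circ$ equals $Q_{s,k}$ for all $s$ and $k$. Put $V=Q(I-T_{RR})$. Then $Q$ is attainable if and only if, for all $s$ and $k$, $V_{s,k}=0$ when $C_{s,k}=0$, and $V_{s,k}>0$ when $C_{s,k}=1$. -/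

import Mathlib

open scoped Matrix Classical

noncomputable section

/-- A weakly-connected social network whose internal receiving weights `TRR` are fixed.
`S` indexes the sending sub-networks, `J` is the set of sending agents, `K` the set of
receiving agents and `Θ` the set of possible states.  The matrix convention is that the entry
`(ℓ, k)` is the weight with which agent `k` scales the data arriving from agent `ℓ`. -/
structure WeakNetwork (S J K Θ : Type*) [Fintype K] where
  /-- the sending sub-network to which a sending agent belongs -/
  subnet : J → S
  /-- the true state of each sending sub-network -/
  trueState : S → Θ
  /-- the true states of the sending sub-networks are distinct -/
  trueState_injective : Function.Injective trueState
  /-- `link j k`: there is a link from the sending agent `j` to the receiving agent `k` -/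
  link : J → K → Prop
  /-- the weights inside the receiving part of the network -/
  TRR : Matrix K K ℝ
  TRR_nonneg : ∀ l k, 0 ≤ TRR l k
  /-- the weights used by a receiving agent are part of a convex combination -/
  TRR_colSum_le_one : ∀ k, ∑ l, TRR l k ≤ 1
  /-- information from the sending sub-networks reaches every receiving agent: there is a directed
  path (possibly of length zero) inside the receiving part, with positive weights, that leads to
  the agent from a receiving agent linked to some sending agent -/
  reached : ∀ k, ∃ l, (∃ j, link j l) ∧ Relation.ReflTransGen (fun a b => 0 < TRR a b) l k

namespace WeakNetwork

variable {S J K Θ : Type*} [Fintype S] [Fintype J] [Fintype K] [DecidableEq K]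

/-- The connectivity indicator: its `(s, k)` entry is one if the receiving agent `k` is linked to
at least one agent of the sending sub-network `s`, and zero otherwise. -/
def C (N : WeakNetwork S J K Θ) : Matrix S K ℝ :=
  Matrix.of fun s k => if ∃ j, N.subnet j = s ∧ N.link j k then 1 else 0

/-- Admissible weights from the sending agents to the receiving agents. -/
structure Admissible (N : WeakNetwork S J K Θ) (TSR : Matrix J K ℝ) : Prop where
  /-- the weights used by each receiving agent add up to one -/
  colSum : ∀ k, ∑ j, TSR j k + ∑ l, N.TRR l k = 1
  nonneg : ∀ j k, 0 ≤ TSR j k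
  /-- link sparsity -/
  sparse : ∀ j k, ¬ N.link j k → TSR j k = 0
  /-- the connections between sending sub-networks and receiving agents are kept: an agent linked
  to a sub-network gives positive weight to at least one of the agents of that sub-network
  (individual links may have weight zero) -/
  connected : ∀ s k, N.C s k = 1 → ∃ j, N.subnet j = s ∧ 0 < TSR j k

/-- The matrix `W = TSR (I - TRR)⁻¹`. -/
def W (N : WeakNetwork S J K Θ) (TSR : Matrix J K ℝ) : Matrix J K ℝ :=
  TSR * (1 - N.TRR)⁻¹

/-- The limiting belief of the receiving agent `k` at the state `θ`.  The limiting belief of each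
agent of the sending sub-network `s` is the point mass at the true state of `s`, and the limiting
beliefs of the receiving agents are the combinations of these with weights `W`. -/
def limitingBelief (N : WeakNetwork S J K Θ) (TSR : Matrix J K ℝ) (k : K) (θ : Θ) : ℝ :=
  ∑ s, ∑ j with N.subnet j = s, N.W TSR j k * (if θ = N.trueState s then 1 else 0)

/-- `Q` is attainable: some admissible `TSR` makes `Q s k` the limiting belief of each receiving
agent `k` at the true state of each sending sub-network `s`. -/
def Attainable (N : WeakNetwork S J K Θ) (Q : Matrix S K ℝ) : Prop :=
  ∃ TSR : Matrix J K ℝ, N.Admissible TSR ∧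
    ∀ s k, N.limitingBelief TSR k (N.trueState s) = Q s k

/-- The difference matrix `V = Q (I - TRR)`. -/
def V (N : WeakNetwork S J K Θ) (Q : Matrix S K ℝ) : Matrix S K ℝ :=
  Q * (1 - N.TRR)

end WeakNetwork

/-- A belief matrix: each column is a probability distribution on the sending sub-networks
(equivalently, on their distinct true states). -/
structure IsBeliefMatrix {S K : Type*} [Fintype S] (Q : Matrix S K ℝ) : Prop where
  nonneg : ∀ s k, 0 ≤ Q s k
  colSum : ∀ k, ∑ s, Q s k = 1

end

/-!
The limiting beliefs at the true states form the matrix `E * W`, where `E` sums the rows of each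
sending sub-network (`limitingBelief_trueState`). If `1 - TRR` is invertible, attaining `Q` with
weights `TSR` therefore means `E * TSR = Q * (1 - TRR) = V`: the weights that `k` gives to the
agents of `s` must add up to `V s k` (`limitingBelief_eq_iff`). Admissibility of `TSR` forces such a
sum to be positive where `C s k = 1` and zero where `C s k = 0`. Conversely, when `V` has this sign
pattern, splitting `V s k` evenly among the agents of `s` linked to `k` gives admissible weights; its
columns add up correctly because those of `Q` add up to one.

The invertibility of `1 - TRR` (`isUnit_one_sub_TRR`) holds as soon as the column sums at the
receiving agents with a link are strictly below one, which both sides of the equivalence imply. It is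
a maximum principle: if `x = x * TRR`, then a maximum of `|x|` at `k` is also attained at every
agent to which `k` gives positive weight, hence, going back along a path, at an agent where the
column sum is below one, so that the maximum is zero.
-/

noncomputable section

namespace WeakNetwork

variable {S J K Θ : Type*} [Fintype K]

theorem C_eq_one_iff [Fintype J] (N : WeakNetwork S J K Θ) (s : S) (k : K) :
    N.C s k = 1 ↔ ∃ j, N.subnet j = s ∧ N.link j k := by
  simp [C]

theorem C_eq_zero_iff [Fintype J] (N : WeakNetwork S J K Θ) (s : S) (k : K) :
    N.C s k = 0 ↔ ¬ ∃ j, N.subnet j = s ∧ N.link j k := by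
  simp [C]

/-- One step of the maximum principle: where `|x|` is maximal, the column sum of `TRR` cannot be
below one, and the maximum propagates to every agent with positive weight. -/
theorem abs_eq_of_vecMul_eq_self (N : WeakNetwork S J K Θ) {x : K → ℝ} (hx : x ᵥ* N.TRR = x)
    {M : ℝ} (hM : 0 < M) (hle : ∀ l, |x l| ≤ M) {k : K} (hk : |x k| = M) :
    ∑ l, N.TRR l k = 1 ∧ ∀ l, 0 < N.TRR l k → |x l| = M := by
  have h1 : M ≤ ∑ l, |x l| * N.TRR l k := by
    have hxk : ∑ l, x l * N.TRR l k = x k := congrFun hx k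
    rw [← hk, ← hxk]
    refine (Finset.abs_sum_le_sum_abs _ _).trans_eq (Finset.sum_congr rfl fun l _ => ?_)
    rw [abs_mul, abs_of_nonneg (N.TRR_nonneg l k)]
  have h2 : ∀ l ∈ Finset.univ, |x l| * N.TRR l k ≤ M * N.TRR l k := fun l _ =>
    mul_le_mul_of_nonneg_right (hle l) (N.TRR_nonneg l k)
  have h3 : ∑ l, |x l| * N.TRR l k ≤ M * ∑ l, N.TRR l k := by
    rw [Finset.mul_sum]
    exact Finset.sum_le_sum h2
  have h4 := N.TRR_colSum_le_one k
  have h5 : ∑ l, N.TRR l k = 1 := by nlinarith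
  have h6 : ∑ l, |x l| * N.TRR l k = ∑ l, M * N.TRR l k := by
    rw [← Finset.mul_sum]
    rw [h5] at h3 ⊢
    linarith
  refine ⟨h5, fun l hl => ?_⟩
  exact mul_right_cancel₀ hl.ne' ((Finset.sum_eq_sum_iff_of_le h2).1 h6 l (Finset.mem_univ l))

theorem isUnit_one_sub_TRR [DecidableEq K] (N : WeakNetwork S J K Θ)
    (h : ∀ j k, N.link j k → ∑ l, N.TRR l k < 1) : IsUnit (1 - N.TRR) := by
  rw [Matrix.isUnit_iff_isUnit_det, isUnit_iff_ne_zero]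
  intro hdet
  obtain ⟨x, hx0, hx⟩ := Matrix.exists_vecMul_eq_zero_iff.2 hdet
  rw [Matrix.vecMul_sub, Matrix.vecMul_one, sub_eq_zero] at hx
  obtain ⟨k₀, hk₀⟩ := Function.ne_iff.1 hx0
  have : Nonempty K := ⟨k₀⟩
  obtain ⟨k, hk⟩ := Finite.exists_max fun l => |x l|
  have hM : 0 < |x k| := (abs_pos.2 hk₀).trans_le (hk k₀)
  obtain ⟨l, ⟨j, hj⟩, hpath⟩ := N.reached k
  have hl : |x l| = |x k| := by
    clear hj
    induction hpath using Relation.ReflTransGen.head_induction_on with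
    | refl => rfl
    | head hab _ ih => exact (N.abs_eq_of_vecMul_eq_self hx.symm hM hk ih).2 _ hab
  exact (h j l hj).ne (N.abs_eq_of_vecMul_eq_self hx.symm hM hk hl).1

/-- The indicator matrix of the membership of sending agents in sub-networks; multiplying by it on
the left adds up the rows of each sub-network. -/
def membership (N : WeakNetwork S J K Θ) : Matrix S J ℝ :=
  Matrix.of fun s j => if N.subnet j = s then 1 else 0

theorem membership_mul_apply [Fintype J] (N : WeakNetwork S J K Θ) (A : Matrix J K ℝ) (s : S)
    (k : K) :
    (N.membership * A) s k = ∑ j with N.subnet j = s, A j k := by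
  simp [membership, Matrix.mul_apply, Finset.sum_filter]

theorem limitingBelief_trueState [Fintype S] [Fintype J] [DecidableEq K] (N : WeakNetwork S J K Θ)
    (TSR : Matrix J K ℝ) (s : S) (k : K) :
    N.limitingBelief TSR k (N.trueState s) = (N.membership * N.W TSR) s k := by
  rw [membership_mul_apply, limitingBelief, Finset.sum_eq_single s]
  · simp
  · intro t _ hts
    simp [N.trueState_injective.ne hts.symm]
  · simp

theorem limitingBelief_eq_iff [Fintype S] [Fintype J] [DecidableEq K] (N : WeakNetwork S J K Θ)
    (hu : IsUnit (1 - N.TRR))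
    (TSR : Matrix J K ℝ) (Q : Matrix S K ℝ) :
    (∀ s k, N.limitingBelief TSR k (N.trueState s) = Q s k) ↔
      ∀ s k, ∑ j with N.subnet j = s, TSR j k = N.V Q s k := by
  have hdet := (Matrix.isUnit_iff_isUnit_det _).1 hu
  simp only [limitingBelief_trueState, ← membership_mul_apply]
  rw [Matrix.ext_iff, Matrix.ext_iff, W, V, ← Matrix.mul_assoc]
  constructor
  · rintro rfl
    rw [Matrix.nonsing_inv_mul_cancel_right _ _ hdet]
  · intro h
    rw [h, Matrix.mul_nonsing_inv_cancel_right _ _ hdet]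

theorem sum_V [Fintype S] [DecidableEq K] (N : WeakNetwork S J K Θ) {Q : Matrix S K ℝ}
    (hQ : IsBeliefMatrix Q) (k : K) :
    ∑ s, N.V Q s k = 1 - ∑ l, N.TRR l k := by
  simp only [V, Matrix.mul_apply]
  rw [Finset.sum_comm]
  simp_rw [← Finset.sum_mul, hQ.colSum, one_mul, Matrix.sub_apply, Finset.sum_sub_distrib,
    Matrix.one_apply]
  simp

/-- The sending weights that split each entry `A s k` evenly among the agents of the sub-network `s`
linked to `k`. -/
def evenSplit [Fintype J] (N : WeakNetwork S J K Θ) (A : Matrix S K ℝ) : Matrix J K ℝ :=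
  Matrix.of fun j k => if N.link j k then
    A (N.subnet j) k / (Finset.univ.filter fun i => N.subnet i = N.subnet j ∧ N.link i k).card
  else 0

theorem sum_evenSplit [Fintype J] (N : WeakNetwork S J K Θ) {A : Matrix S K ℝ}
    (hA : ∀ s k, N.C s k = 0 → A s k = 0) (s : S) (k : K) :
    ∑ j with N.subnet j = s, N.evenSplit A j k = A s k := by
  set L := Finset.univ.filter fun i => N.subnet i = s ∧ N.link i k with hL
  have h : ∑ j with N.subnet j = s, N.evenSplit A j k = ∑ j ∈ L, A s k / L.card := by
    rw [hL, ← Finset.filter_filter, Finset.sum_filter (fun j => N.link j k)]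
    refine Finset.sum_congr rfl fun j hj => ?_
    obtain rfl := (Finset.mem_filter.1 hj).2
    rw [Finset.filter_filter]
    rfl
  rw [h, Finset.sum_const, nsmul_eq_mul]
  rcases L.eq_empty_or_nonempty with h0 | h0
  · rw [hA s k, h0]
    · simp
    · rw [C_eq_zero_iff]
      rintro ⟨j, hj⟩
      have : j ∈ L := by simpa [hL] using hj
      simp [h0] at this
  · exact mul_div_cancel₀ _ (Nat.cast_ne_zero.2 h0.card_ne_zero)

theorem evenSplit_pos [Fintype J] (N : WeakNetwork S J K Θ) {A : Matrix S K ℝ} {j : J} {k : K}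
    (hj : N.link j k) (hA : 0 < A (N.subnet j) k) : 0 < N.evenSplit A j k := by
  have : (Finset.univ.filter fun i => N.subnet i = N.subnet j ∧ N.link i k).Nonempty :=
    ⟨j, by simpa using hj⟩
  simp only [evenSplit, Matrix.of_apply, if_pos hj]
  exact div_pos hA (Nat.cast_pos.2 this.card_pos)

theorem Admissible.colSum_TRR_lt_one [Fintype J] {N : WeakNetwork S J K Θ} {TSR : Matrix J K ℝ}
    (h : N.Admissible TSR) {j : J} {k : K} (hj : N.link j k) : ∑ l, N.TRR l k < 1 := by
  obtain ⟨i, -, hi⟩ := h.connected (N.subnet j) k ((N.C_eq_one_iff _ _).2 ⟨j, rfl, hj⟩)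
  have : 0 < ∑ j, TSR j k :=
    Finset.sum_pos' (fun i _ => h.nonneg i k) ⟨i, Finset.mem_univ i, hi⟩
  linarith [h.colSum k]

theorem admissible_evenSplit [Fintype S] [Fintype J] [DecidableEq K] (N : WeakNetwork S J K Θ)
    {Q : Matrix S K ℝ} (hQ : IsBeliefMatrix Q)
    (h0 : ∀ s k, N.C s k = 0 → N.V Q s k = 0) (h1 : ∀ s k, N.C s k = 1 → 0 < N.V Q s k) :
    N.Admissible (N.evenSplit (N.V Q)) where
  colSum k := by
    rw [← Finset.sum_fiberwise Finset.univ N.subnet]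
    have h (s : S) : ∑ j with N.subnet j = s, N.evenSplit (N.V Q) j k = N.V Q s k :=
      N.sum_evenSplit h0 s k
    simp_rw [h]
    linarith [N.sum_V hQ k]
  nonneg j k := by
    by_cases hj : N.link j k
    · exact (N.evenSplit_pos hj (h1 _ _ ((N.C_eq_one_iff _ _).2 ⟨j, rfl, hj⟩))).le
    · simp [evenSplit, hj]
  sparse j k hj := by simp [evenSplit, hj]
  connected s k hC := by
    obtain ⟨j, rfl, hj⟩ := (N.C_eq_one_iff s k).1 hC
    exact ⟨j, rfl, N.evenSplit_pos hj (h1 _ _ hC)⟩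

end WeakNetwork

end

theorem theorem1 {S J K Θ : Type*} [Fintype S] [Fintype J] [Fintype K] [DecidableEq K]
    (N : WeakNetwork S J K Θ) (Q : Matrix S K ℝ) (hQ : IsBeliefMatrix Q) :
    N.Attainable Q ↔
      ∀ s k, (N.C s k = 0 → N.V Q s k = 0) ∧ (N.C s k = 1 → 0 < N.V Q s k) := by
  constructor
  · rintro ⟨TSR, hT, hb⟩ s k
    have hu := N.isUnit_one_sub_TRR fun j k hj => hT.colSum_TRR_lt_one hj
    rw [← (N.limitingBelief_eq_iff hu TSR Q).1 hb s k]
    constructor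
    · intro hC
      refine Finset.sum_eq_zero fun j hj => hT.sparse j k fun hl => ?_
      exact (N.C_eq_zero_iff s k).1 hC ⟨j, (Finset.mem_filter.1 hj).2, hl⟩
    · intro hC
      obtain ⟨j, hjs, hj⟩ := hT.connected s k hC
      exact Finset.sum_pos' (fun i _ => hT.nonneg i k) ⟨j, by simpa using hjs, hj⟩
  · intro h
    have h0 : ∀ s k, N.C s k = 0 → N.V Q s k = 0 := fun s k => (h s k).1
    have h1 : ∀ s k, N.C s k = 1 → 0 < N.V Q s k := fun s k => (h s k).2
    have hT := N.admissible_evenSplit hQ h0 h1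
    have hu := N.isUnit_one_sub_TRR fun j k hj => hT.colSum_TRR_lt_one hj
    exact ⟨_, hT, (N.limitingBelief_eq_iff hu _ Q).2 (N.sum_evenSplit h0)⟩
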